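/- \begin{theorem} Let $k,n\ge 0$ be integers, let $a\in\mathbb R^k$ and $b\in\mathbb R^n$, and let $$P=\Big\{x\in\mathbb R^{k\times n} : x_{ij}\ge 0,\ \sum_{j=1}^n x_{ij}=a_i\ (1\le i\le k),\ \sum_{i=1}^k x_{ij}=b_j\ (1\le j\le n)\Big\}$$ be the $k\times n$ transportation polytope with supplies $a$ and demands $b$. For a linear objective function $c$ that takes distinct values at distinct vertices of $P$, a \emph{$c$-monotone path} is a sequence of vertices of $P$ in which consecutive vertices are joined by an edge of $P$, the value of $c$ strictly decreases at each step, and the last vertex is the minimizer of $c$ over $P$; its length is its number of steps. The \emph{monotone diameter} $\operatorname{mono-diam}(P)$ is the maximum, over all such $c$ and all vertices $v$ of $P$, of the length of a shortest $c$-monotone path starting at $v$ (and $0$ if $P$ is empty). Then $$\operatorname{mono-diam}(P)\le e\cdot k!\, n^k .$$ In particular, for every fixed $k$ there is a polynomial $p$ with natural number coefficients, depending only on $k$, such that every $k\times n$ transportation polytope $P$, for every $n$, satisfies $\operatorname{mono-diam}(P)\le p(n)$. \end{theorem} -/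

import Mathlib

open scoped Nat ENNReal

noncomputable section

section Polytope

variable {E : Type*} [AddCommGroup E] [Module ℝ E] [TopologicalSpace E]

/-- Two points are adjacent in the graph of `P` if they are distinct vertices of `P` and the
segment between them is a face of `P`, i.e. an edge. -/
def PolytopeAdj (P : Set E) (x y : E) : Prop :=
  x ∈ P.extremePoints ℝ ∧ y ∈ P.extremePoints ℝ ∧ x ≠ y ∧ IsExposed ℝ P (segment ℝ x y)

/-- The objective function `c` is nondegenerate on `P`: no two vertices of `P` have the same
objective value. -/
def IsNondegenerateObjective (P : Set E) (c : E →ₗ[ℝ] ℝ) : Prop :=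
  Set.InjOn c (P.extremePoints ℝ)

/-- `w` is an optimal vertex for the problem of minimizing `c` over `P` (there is only one
when `P` is a nonempty polytope and `c` is nondegenerate). -/
def IsOptimalVertex (P : Set E) (c : E →ₗ[ℝ] ℝ) (w : E) : Prop :=
  w ∈ P.extremePoints ℝ ∧ ∀ x ∈ P, c w ≤ c x

/-- `p 0, p 1, …, p l` is a `c`-monotone path (of length `l`): it runs along edges of `P`, the
objective value decreases strictly along each of them, and it ends at the optimal vertex. -/
def IsMonotonePath (P : Set E) (c : E →ₗ[ℝ] ℝ) (l : ℕ) (p : Fin (l + 1) → E) : Prop :=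
  p 0 ∈ P.extremePoints ℝ ∧
  (∀ i : Fin l, PolytopeAdj P (p i.castSucc) (p i.succ) ∧ c (p i.succ) < c (p i.castSucc)) ∧
  IsOptimalVertex P c (p (Fin.last l))

/-- The length of a shortest `c`-monotone path from `v` to the optimum (`⊤` if there is none). -/
def shortestMonotonePathLength (P : Set E) (c : E →ₗ[ℝ] ℝ) (v : E) : ℕ∞ :=
  ⨅ (l : ℕ) (_ : ∃ p : Fin (l + 1) → E, p 0 = v ∧ IsMonotonePath P c l p), (l : ℕ∞)

/-- The `c`-monotone diameter: the maximum, over all starting vertices `v`, of the length of a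
shortest `c`-monotone path from `v` to the optimum. -/
def objectiveMonotoneDiameter (P : Set E) (c : E →ₗ[ℝ] ℝ) : ℕ∞ :=
  ⨆ v ∈ P.extremePoints ℝ, shortestMonotonePathLength P c v

/-- The monotone diameter of `P`: the maximum of the `c`-monotone diameters over all
nondegenerate linear objective functions `c`. -/
def monotoneDiameter (P : Set E) : ℕ∞ :=
  ⨆ (c : E →ₗ[ℝ] ℝ) (_ : IsNondegenerateObjective P c), objectiveMonotoneDiameter P c

end Polytope

/-- The `k × n` transportation polytope with supplies `a` and demands `b`. -/
def transportationPolytope {k n : ℕ} (a : Fin k → ℝ) (b : Fin n → ℝ) :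
    Set (Matrix (Fin k) (Fin n) ℝ) :=
  {x | (∀ i j, 0 ≤ x i j) ∧ (∀ i, ∑ j, x i j = a i) ∧ (∀ j, ∑ i, x i j = b j)}

end

open Finset Matrix Polynomial Filter Topology

variable {k n : ℕ}

/-! The proof follows a shadow vertex path and counts its possible slopes. Circuits are signed
incidence matrices of closed walks in the complete bipartite graph on rows and columns that repeat
no row. A difference of two points of the polytope is a conformal sum of circuits
(`exists_conformal_decomposition`), so optimality of a point need only be tested on the circuits
feasible there. Given `c` and a vertex `v`, `exists_generic_lexOptimal` supplies a generic `w`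
minimized only at `v`. As `t` grows from 0, the minimizer of `w + t • c` moves along edges until it
minimizes `c` (`exists_shadow_step`). A step along a circuit `d` happens at `t = w d / -c d`, and
these values strictly increase, so distinct steps use distinct circuits. The path is therefore no
longer than the number of circuits, which is at most `e * k! * n ^ k`. -/

/-! ### Circulations and circuits. -/

/-- The `k × n` matrices all of whose row sums and column sums vanish. -/
def circulations (k n : ℕ) : Submodule ℝ (Matrix (Fin k) (Fin n) ℝ) where
  carrier := {z | (∀ i, ∑ j, z i j = 0) ∧ ∀ j, ∑ i, z i j = 0}
  zero_mem' := by simp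
  add_mem' := by
    rintro y z ⟨hy, hy'⟩ ⟨hz, hz'⟩
    simp [sum_add_distrib, hy, hy', hz, hz']
  smul_mem' := by
    rintro r z ⟨hz, hz'⟩
    simp [← mul_sum, hz, hz']

/-- `d` is conformal to `z` if every nonzero entry of `d` has the sign of that entry of `z`. -/
def IsConformal (d z : Matrix (Fin k) (Fin n) ℝ) : Prop :=
  ∀ i j, (0 < d i j → 0 < z i j) ∧ (d i j < 0 → z i j < 0)

/-- The signed incidence matrix of the closed walk through the rows `p l` and columns `q l`. -/
def cycleMatrix {m : ℕ} (p : Fin (m + 1) → Fin k) (q : Fin (m + 1) → Fin n) :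
    Matrix (Fin k) (Fin n) ℝ :=
  ∑ l, (Matrix.single (p l) (q l) 1 - Matrix.single (p (l + 1)) (q l) 1)

theorem cycleMatrix_apply {m : ℕ} (p : Fin (m + 1) → Fin k) (q : Fin (m + 1) → Fin n) (i : Fin k)
    (j : Fin n) : cycleMatrix p q i j =
      ∑ l, ((if p l = i ∧ q l = j then (1 : ℝ) else 0) -
        if p (l + 1) = i ∧ q l = j then 1 else 0) := by
  simp [cycleMatrix, Matrix.sum_apply, Matrix.single_apply]

theorem cycleMatrix_mem_circulations {m : ℕ} (p : Fin (m + 1) → Fin k)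
    (q : Fin (m + 1) → Fin n) : cycleMatrix p q ∈ circulations k n := by
  constructor
  · intro i
    have h : ∑ l, (if p (l + 1) = i then (1 : ℝ) else 0) = ∑ l, if p l = i then (1 : ℝ) else 0 :=
      Equiv.sum_comp (Equiv.addRight 1) fun l => if p l = i then (1 : ℝ) else 0
    simp_rw [cycleMatrix_apply]
    rw [sum_comm]
    simp [ite_and, h]
  · intro j
    simp_rw [cycleMatrix_apply]
    rw [sum_comm]
    refine sum_eq_zero fun l _ => ?_
    simp [ite_and]

/-- A positive entry needs a term `1` at some `(p l, q l)`, a negative one a term `-1` at some `(p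
(l + 1), q l)`, and `z` has that sign there. -/
theorem conformal_cycleMatrix {m : ℕ} {p : Fin (m + 1) → Fin k} {q : Fin (m + 1) → Fin n}
    {z : Matrix (Fin k) (Fin n) ℝ} (hpos : ∀ l, 0 < z (p l) (q l))
    (hneg : ∀ l, z (p (l + 1)) (q l) < 0) : IsConformal (cycleMatrix p q) z := by
  intro i j
  rw [cycleMatrix_apply]
  constructor <;> intro h <;> by_contra hz
  · refine absurd (sum_nonpos fun l _ => ?_) h.not_ge
    have : ¬ (p l = i ∧ q l = j) := by
      rintro ⟨rfl, rfl⟩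
      exact hz (hpos l)
    rw [if_neg this]
    split_ifs <;> norm_num
  · refine absurd (sum_nonneg fun l _ => ?_) h.not_ge
    have : ¬ (p (l + 1) = i ∧ q l = j) := by
      rintro ⟨rfl, rfl⟩
      exact hz (hneg l)
    rw [if_neg this]
    split_ifs <;> norm_num

/-- The signs of `z` keep the positions of the terms `1` and `-1` disjoint, so nothing cancels at
`(p 0, q 0)`. -/
theorem cycleMatrix_ne_zero {m : ℕ} {p : Fin (m + 1) → Fin k} {q : Fin (m + 1) → Fin n}
    {z : Matrix (Fin k) (Fin n) ℝ} (hpos : ∀ l, 0 < z (p l) (q l))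
    (hneg : ∀ l, z (p (l + 1)) (q l) < 0) : cycleMatrix p q ≠ 0 := by
  intro h
  have h0 : cycleMatrix p q (p 0) (q 0) = 0 := by rw [h]; rfl
  rw [cycleMatrix_apply] at h0
  have hn : ∀ l, ¬ (p (l + 1) = p 0 ∧ q l = q 0) := by
    rintro l ⟨h1, h2⟩
    have := hneg l
    rw [h1, h2] at this
    exact absurd (hpos 0) this.not_gt
  simp only [hn, if_false, sub_zero] at h0
  have := (sum_eq_zero_iff_of_nonneg fun l _ => by split_ifs <;> norm_num).1 h0 0 (mem_univ _)
  simp at this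

open Classical in
/-- The nonzero signed incidence matrices of closed walks in the complete bipartite graph that
visit every row at most once. -/
noncomputable def circuits (k n : ℕ) : Finset (Matrix (Fin k) (Fin n) ℝ) :=
  (univ.image fun s : Σ m : Fin k, (Fin (m + 1) ↪ Fin k) × (Fin (m + 1) → Fin n) =>
    cycleMatrix s.2.1 s.2.2).filter (· ≠ 0)

theorem ne_zero_of_mem_circuits {d : Matrix (Fin k) (Fin n) ℝ} (hd : d ∈ circuits k n) :
    d ≠ 0 := by
  classical
  exact (mem_filter.1 hd).2

theorem mem_circulations_of_mem_circuits {d : Matrix (Fin k) (Fin n) ℝ}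
    (hd : d ∈ circuits k n) : d ∈ circulations k n := by
  classical
  obtain ⟨s, -, rfl⟩ := mem_image.1 (mem_filter.1 hd).1
  exact cycleMatrix_mem_circulations _ _

/-! ### Counting circuits. -/

/-- A circuit is given by an injective sequence of `m + 1 ≤ k` rows and an arbitrary sequence of `m
+ 1` columns. -/
theorem card_circuits_le (k n : ℕ) :
    #(circuits k n) ≤ ∑ m ∈ range k, k.descFactorial (m + 1) * n ^ (m + 1) := by
  classical
  refine (card_filter_le _ _).trans (card_image_le.trans ?_)
  rw [card_univ, Fintype.card_sigma, ← Fin.sum_univ_eq_sum_range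
    (fun m => k.descFactorial (m + 1) * n ^ (m + 1))]
  simp [Fintype.card_embedding_eq]

/-- Each falling factorial is `k! / (k - 1 - m)!` and each power of `n` is at most `n ^ k`; the
reciprocal factorials sum to at most `e`. -/
theorem sum_descFactorial_mul_pow_le (k n : ℕ) :
    ((∑ m ∈ range k, k.descFactorial (m + 1) * n ^ (m + 1) : ℕ) : ℝ) ≤
      Real.exp 1 * (k ! : ℝ) * (n : ℝ) ^ k := by
  have key : ∀ m ∈ range k, (k.descFactorial (m + 1) * n ^ (m + 1) : ℝ) ≤
      (1 ^ (k - 1 - m) / (k - 1 - m)! : ℝ) * ((k ! : ℝ) * (n : ℝ) ^ k) := by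
    intro m hm
    have hm' : m + 1 ≤ k := mem_range.1 hm
    have h1 : ((k - 1 - m)! : ℝ) * k.descFactorial (m + 1) = k ! := by
      rw [Nat.sub_sub, add_comm 1 m]
      exact_mod_cast Nat.factorial_mul_descFactorial hm'
    have h2 : (n : ℝ) ^ (m + 1) ≤ (n : ℝ) ^ k := by
      rcases Nat.eq_zero_or_pos n with rfl | hn
      -- Here `k > 0` because `m < k`, so both powers of 0 vanish.
      · simp [zero_pow (show k ≠ 0 by omega)]
      · exact pow_le_pow_right₀ (by exact_mod_cast hn) hm'
    have h3 : ((k - 1 - m)! : ℝ) ≠ 0 := by positivity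
    rw [← h1]
    calc (k.descFactorial (m + 1) * n ^ (m + 1) : ℝ)
        ≤ k.descFactorial (m + 1) * (n : ℝ) ^ k := by gcongr
      _ = _ := by field_simp; simp
  push_cast
  refine (sum_le_sum key).trans ?_
  rw [← sum_mul, sum_range_reflect (fun i => (1 ^ i / i ! : ℝ)) k, mul_assoc]
  gcongr
  exact Real.sum_le_exp_of_nonneg zero_le_one k

/-! ### Conformal decomposition. -/

/-- A self-map of a finite type has a cycle. -/
theorem exists_injective_cycle {α : Type*} [Finite α] [Nonempty α] (g : α → α) :
    ∃ (m : ℕ) (p : Fin (m + 1) → α), Function.Injective p ∧ ∀ l, p (l + 1) = g (p l) := by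
  obtain ⟨x⟩ := ‹Nonempty α›
  obtain ⟨a, b, hab, h⟩ := Finite.exists_ne_map_eq_of_infinite fun t : ℕ => g^[t] x
  wlog hlt : a < b generalizing a b
  · exact this b a hab.symm h.symm (by omega)
  -- Orbits are eventually periodic; going once around the minimal period of `g^[a] x` gives an
  -- injective cycle.
  have hper : Function.IsPeriodicPt g (b - a) (g^[a] x) := by
    change g^[b - a] (g^[a] x) = g^[a] x
    rw [← Function.iterate_add_apply, Nat.sub_add_cancel hlt.le]
    exact h.symm
  set y := g^[a] x
  obtain ⟨m, hm⟩ := Nat.exists_eq_succ_of_ne_zero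
    (hper.minimalPeriod_pos (by omega)).ne'
  refine ⟨m, fun l => g^[l] y, fun l l' hl => Fin.ext ?_, fun l => ?_⟩
  · exact Function.iterate_injOn_Iio_minimalPeriod
      (by simpa [hm] using l.2) (by simpa [hm] using l'.2) hl
  · have : ((l + 1 : Fin (m + 1)) : ℕ) = (l + 1) % Function.minimalPeriod g y := by
      rw [hm, Fin.val_add]
      simp
    simp only [this, Function.iterate_mod_minimalPeriod_eq, Function.iterate_succ_apply']

/-- From a positive entry, its column contains a negative one, whose row again contains a positive
one. This is a self-map of the rows having a positive entry, and a cycle of it is the required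
closed walk. -/
theorem exists_conformal_circuit {z : Matrix (Fin k) (Fin n) ℝ} (hz : z ∈ circulations k n)
    (h0 : z ≠ 0) : ∃ d ∈ circuits k n, IsConformal d z := by
  classical
  have hrow : ∀ i j, z i j < 0 → ∃ j', 0 < z i j' := by
    intro i j hij
    by_contra! h
    exact absurd (sum_neg' (fun j' _ => h j') ⟨j, mem_univ _, hij⟩) (hz.1 i).not_lt
  have hcol : ∀ i j, 0 < z i j → ∃ i', z i' j < 0 := by
    intro i j hij
    by_contra! h
    exact absurd (sum_pos' (fun i' _ => h i') ⟨i, mem_univ _, hij⟩) (hz.2 j).not_gt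
  have hne : ∃ i j, 0 < z i j := by
    by_contra! h
    apply h0
    ext i j
    by_contra hij
    obtain ⟨j', hj'⟩ := hrow i j (lt_of_le_of_ne (h i j) hij)
    exact absurd hj' (h i j').not_gt
  have hstep : ∀ i : {i // ∃ j, 0 < z i j}, ∃ (i' : {i // ∃ j, 0 < z i j}) (j : Fin n),
      0 < z i j ∧ z i' j < 0 := by
    rintro ⟨i, j, hij⟩
    obtain ⟨i', hi'⟩ := hcol i j hij
    exact ⟨⟨i', hrow i' j hi'⟩, j, hij, hi'⟩
  choose g σ hpos hneg using hstep
  have : Nonempty {i // ∃ j, 0 < z i j} := hne.elim fun i hi => ⟨⟨i, hi⟩⟩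
  obtain ⟨m, p, hp, hpg⟩ := exists_injective_cycle g
  let p' : Fin (m + 1) ↪ Fin k := ⟨fun l => (p l).1, Subtype.val_injective.comp hp⟩
  have hm : m < k := by simpa using Fintype.card_le_of_embedding p'
  have h1 : ∀ l, 0 < z (p' l) (σ (p l)) := fun l => hpos _
  have h2 : ∀ l, z (p' (l + 1)) (σ (p l)) < 0 := fun l => by
    change z (p (l + 1)).1 _ < 0
    rw [hpg]
    exact hneg _
  refine ⟨cycleMatrix p' fun l => σ (p l), mem_filter.2 ⟨mem_image.2
    ⟨⟨⟨m, hm⟩, p', fun l => σ (p l)⟩, mem_univ _, rfl⟩, cycleMatrix_ne_zero h1 h2⟩,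
    conformal_cycleMatrix h1 h2⟩

/-- Every circulation is a conformal nonnegative combination of circuits. -/
theorem exists_conformal_decomposition {z : Matrix (Fin k) (Fin n) ℝ}
    (hz : z ∈ circulations k n) : ∃ r : Matrix (Fin k) (Fin n) ℝ → ℝ,
      (∀ d, 0 ≤ r d) ∧ (∀ d, r d ≠ 0 → IsConformal d z) ∧ z = ∑ d ∈ circuits k n, r d • d := by
  classical
  induction hN : #{s : Fin k × Fin n | z s.1 s.2 ≠ 0} using Nat.strong_induction_on
    generalizing z with
  | _ N ih =>
  by_cases h0 : z = 0
  · exact ⟨0, by simp, by simp, by simp [h0]⟩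
  obtain ⟨d, hd, hdz⟩ := exists_conformal_circuit hz h0
  have hne : ({s : Fin k × Fin n | d s.1 s.2 ≠ 0} : Finset _).Nonempty := by
    by_contra h
    rw [not_nonempty_iff_eq_empty, filter_eq_empty_iff] at h
    refine ne_zero_of_mem_circuits hd ?_
    ext i j
    simpa using h (mem_univ (i, j))
  -- Ratio test: `ε` is the largest multiple of `d` that can be subtracted without an entry of `z`
  -- changing sign, and the minimizing entry becomes zero.
  obtain ⟨⟨i₀, j₀⟩, hs₀, hmin⟩ := exists_min_image _ (fun s => z s.1 s.2 / d s.1 s.2) hne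
  have hd₀ : d i₀ j₀ ≠ 0 := (mem_filter.1 hs₀).2
  set ε := z i₀ j₀ / d i₀ j₀ with hε
  have hε0 : 0 < ε := by
    rcases lt_or_gt_of_ne hd₀ with h | h
    · exact div_pos_of_neg_of_neg ((hdz i₀ j₀).2 h) h
    · exact div_pos ((hdz i₀ j₀).1 h) h
  have hle : ∀ i j, d i j ≠ 0 → ε ≤ z i j / d i j := fun i j h =>
    hmin (i, j) (mem_filter.2 ⟨mem_univ _, h⟩)
  have happ : ∀ i j, (z - ε • d) i j = z i j - ε * d i j := fun i j => rfl
  have hconf : IsConformal (z - ε • d) z := by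
    intro i j
    rw [happ]
    rcases lt_trichotomy (d i j) 0 with h | h | h
    · have h1 := hle i j h.ne
      rw [le_div_iff_of_neg h] at h1
      have h2 := (hdz i j).2 h
      exact ⟨fun h3 => by linarith, fun _ => h2⟩
    · simp [h]
    · have h1 := hle i j h.ne'
      rw [le_div_iff₀ h] at h1
      have h2 := (hdz i j).1 h
      exact ⟨fun _ => h2, fun h3 => by linarith⟩
  have hlt : #{s : Fin k × Fin n | (z - ε • d) s.1 s.2 ≠ 0} < N := by
    rw [← hN]
    refine card_lt_card (Finset.ssubset_iff_of_subset ?_ |>.2 ⟨(i₀, j₀), ?_, ?_⟩)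
    · intro s hs
      rw [mem_filter] at hs ⊢
      refine ⟨hs.1, ?_⟩
      rcases lt_or_gt_of_ne hs.2 with h | h
      · exact ((hconf _ _).2 h).ne
      · exact ((hconf _ _).1 h).ne'
    · rw [mem_filter]
      refine ⟨mem_univ _, fun h => ?_⟩
      simp only at h
      rw [hε, h, zero_div] at hε0
      exact lt_irrefl _ hε0
    · rw [mem_filter, happ, hε]
      simp [hd₀]
  obtain ⟨r, hr0, hrc, hr⟩ := ih _ hlt (sub_mem hz (Submodule.smul_mem _ _
    (mem_circulations_of_mem_circuits hd))) rfl
  refine ⟨fun e => r e + if e = d then ε else 0, fun e => ?_, fun e he => ?_, ?_⟩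
  · have := hr0 e
    dsimp only
    split_ifs <;> linarith
  · by_cases hed : e = d
    · rwa [hed]
    · have he' : r e ≠ 0 := by simpa [hed] using he
      intro i j
      exact ⟨fun h => (hconf i j).1 ((hrc e he' i j).1 h),
        fun h => (hconf i j).2 ((hrc e he' i j).2 h)⟩
  · simp only [add_smul, sum_add_distrib, ← hr, ite_smul, zero_smul, sum_ite_eq', hd, if_true]
    abel

/-! ### Feasible directions and optimality. -/

/-- `d` is a feasible direction at the nonnegative matrix `x`. -/
def Feasible (x d : Matrix (Fin k) (Fin n) ℝ) : Prop :=
  ∀ i j, x i j = 0 → 0 ≤ d i j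

section Path

variable {a : Fin k → ℝ} {b : Fin n → ℝ} {x y v d z : Matrix (Fin k) (Fin n) ℝ}

theorem sub_mem_circulations (hx : x ∈ transportationPolytope a b)
    (hy : y ∈ transportationPolytope a b) : y - x ∈ circulations k n := by
  constructor <;> intro i
  · simp [hx.2.1 i, hy.2.1 i]
  · simp [hx.2.2 i, hy.2.2 i]

theorem add_mem_transportationPolytope (hx : x ∈ transportationPolytope a b)
    (hz : z ∈ circulations k n) (h : ∀ i j, 0 ≤ x i j + z i j) :
    x + z ∈ transportationPolytope a b := by
  refine ⟨h, fun i => ?_, fun j => ?_⟩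
  · simp [sum_add_distrib, hx.2.1 i, hz.1 i]
  · simp [sum_add_distrib, hx.2.2 j, hz.2 j]

theorem IsConformal.feasible (hy : y ∈ transportationPolytope a b) (h : IsConformal d (y - x)) : Feasible x d := by
  intro i j hij
  by_contra! hd
  have h1 := (h i j).2 hd
  rw [Matrix.sub_apply, hij, sub_zero] at h1
  exact absurd (hy.1 i j) h1.not_ge

theorem Feasible.eventually_add_smul_mem (hx : x ∈ transportationPolytope a b)
    (hd : d ∈ circulations k n) (h : Feasible x d) :
    ∀ᶠ ε : ℝ in 𝓝[>] 0, x + ε • d ∈ transportationPolytope a b := by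
  have key : ∀ i j, ∀ᶠ ε : ℝ in 𝓝[>] 0, 0 ≤ x i j + ε * d i j := by
    intro i j
    rcases (hx.1 i j).eq_or_lt with h0 | h0
    · filter_upwards [self_mem_nhdsWithin] with ε hε
      rw [← h0, zero_add]
      exact mul_nonneg (le_of_lt hε) (h i j h0.symm)
    · have : Tendsto (fun ε : ℝ => x i j + ε * d i j) (𝓝[>] 0) (𝓝 (x i j + 0 * d i j)) :=
        (Continuous.tendsto (by fun_prop) 0).mono_left nhdsWithin_le_nhds
      rw [zero_mul, add_zero] at this
      exact (this.eventually (lt_mem_nhds h0)).mono fun ε hε => le_of_lt hε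
  filter_upwards [eventually_all.2 fun i => eventually_all.2 (key i)] with ε hε
  exact add_mem_transportationPolytope hx (Submodule.smul_mem _ _ hd) hε

/-- Otherwise `v + ε • z` and `v - ε • z` both lie in the polytope for small `ε`, with midpoint `v`.
-/
theorem exists_eq_zero_and_ne_zero_of_mem_extremePoints
    (hv : v ∈ (transportationPolytope a b).extremePoints ℝ) (hz : z ∈ circulations k n)
    (h0 : z ≠ 0) : ∃ i j, v i j = 0 ∧ z i j ≠ 0 := by
  by_contra! h
  have h1 : Feasible v z := fun i j hij => (h i j hij).ge
  have h2 : Feasible v (-z) := fun i j hij => by simp [h i j hij]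
  obtain ⟨ε, ⟨hε1, hε2⟩, hε⟩ := ((h1.eventually_add_smul_mem hv.1 hz).and
    (h2.eventually_add_smul_mem hv.1 (neg_mem hz))).and self_mem_nhdsWithin |>.exists
  have hmid : v ∈ openSegment ℝ (v + ε • z) (v + ε • -z) :=
    ⟨1 / 2, 1 / 2, by norm_num, by norm_num, by norm_num, by
      ext i j
      simp
      ring⟩
  have := hv.2 hε1 hε2 hmid
  simp only [add_eq_left, smul_eq_zero, h0, or_false] at this
  exact (ne_of_gt hε) this

theorem exists_neg_of_mem_circulations (hz : z ∈ circulations k n) (h0 : z ≠ 0) :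
    ∃ i j, z i j < 0 := by
  by_contra! h
  apply h0
  ext i j
  exact (sum_eq_zero_iff_of_nonneg fun j _ => h i j).1 (hz.1 i) j (mem_univ j)

/-- If no circuit that is feasible at `x` decreases `c`, then `x` minimizes `c`. -/
theorem le_of_forall_feasible_circuit_nonneg {c : Matrix (Fin k) (Fin n) ℝ →ₗ[ℝ] ℝ}
    (hx : x ∈ transportationPolytope a b) (h : ∀ d ∈ circuits k n, Feasible x d → 0 ≤ c d)
    (hy : y ∈ transportationPolytope a b) : c x ≤ c y := by
  obtain ⟨r, hr0, hrc, hr⟩ := exists_conformal_decomposition (sub_mem_circulations hx hy)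
  rw [← sub_nonneg, ← map_sub, hr, map_sum]
  refine sum_nonneg fun d hd => ?_
  rw [map_smul, smul_eq_mul]
  by_cases hrd : r d = 0
  · simp [hrd]
  · exact mul_nonneg (hr0 d) (h d hd ((hrc d hrd).feasible hy))

/-- If a functional is nonnegative on the feasible circuits at `x`, and those on which it vanishes
lie on one ray, then the points of the polytope with the same value as `x` lie on that ray. -/
theorem exists_eq_add_smul_of_eq {f : Matrix (Fin k) (Fin n) ℝ →ₗ[ℝ] ℝ}
    (hx : x ∈ transportationPolytope a b) (h : ∀ e ∈ circuits k n, Feasible x e → 0 ≤ f e)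
    (h' : ∀ e ∈ circuits k n, Feasible x e → f e = 0 → ∃ μ : ℝ, 0 ≤ μ ∧ e = μ • d)
    (hy : y ∈ transportationPolytope a b) (hxy : f y = f x) :
    ∃ μ : ℝ, 0 ≤ μ ∧ y = x + μ • d := by
  obtain ⟨r, hr0, hrc, hr⟩ := exists_conformal_decomposition (sub_mem_circulations hx hy)
  have hfe : ∀ e ∈ circuits k n, 0 ≤ r e * f e := by
    intro e he
    by_cases hre : r e = 0
    · simp [hre]
    · exact mul_nonneg (hr0 e) (h e he ((hrc e hre).feasible hy))
  have hsum : ∑ e ∈ circuits k n, r e * f e = 0 := by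
    have := congrArg f hr
    rw [map_sub, hxy, sub_self, map_sum] at this
    simpa using this.symm
  have hz := (sum_eq_zero_iff_of_nonneg hfe).1 hsum
  have hray : ∀ e, ∃ μ : ℝ, 0 ≤ μ ∧ (e ∈ circuits k n → r e • e = μ • d) := by
    intro e
    by_cases he : e ∈ circuits k n
    · by_cases hre : r e = 0
      · exact ⟨0, le_rfl, fun _ => by simp [hre]⟩
      · obtain ⟨μ, hμ, hμe⟩ := h' e he ((hrc e hre).feasible hy)
          ((mul_eq_zero.1 (hz e he)).resolve_left hre)
        refine ⟨r e * μ, mul_nonneg (hr0 e) hμ, fun _ => ?_⟩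
        conv_lhs => rw [hμe, smul_smul]
        rw [← hμe]
    · exact ⟨0, le_rfl, fun h => absurd h he⟩
  choose μ hμ hμe using hray
  refine ⟨∑ e ∈ circuits k n, μ e, sum_nonneg fun e _ => hμ e, ?_⟩
  rw [sum_smul, ← sum_congr rfl fun e he => hμe e he, ← hr]
  abel

/-- The longest step from `x` in a direction that is feasible and nonzero. -/
theorem exists_max_step (hx : x ∈ transportationPolytope a b) (hd : d ∈ circulations k n)
    (h0 : d ≠ 0) (hfeas : Feasible x d) :
    ∃ t : ℝ, 0 < t ∧ ∀ μ : ℝ, 0 ≤ μ → (x + μ • d ∈ transportationPolytope a b ↔ μ ≤ t) := by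
  classical
  obtain ⟨i₁, j₁, h₁⟩ := exists_neg_of_mem_circulations hd h0
  -- Only the negative entries of `d` limit the step.
  obtain ⟨⟨i₀, j₀⟩, hs₀, hmin⟩ := exists_min_image
    ({s : Fin k × Fin n | d s.1 s.2 < 0} : Finset _) (fun s => x s.1 s.2 / -d s.1 s.2)
    ⟨(i₁, j₁), by simpa using h₁⟩
  have hd₀ : d i₀ j₀ < 0 := (mem_filter.1 hs₀).2
  refine ⟨x i₀ j₀ / -d i₀ j₀, div_pos ?_ (by linarith), fun μ hμ => ⟨fun h => ?_, fun h => ?_⟩⟩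
  · refine (hx.1 i₀ j₀).lt_of_ne fun h => ?_
    exact absurd (hfeas i₀ j₀ h.symm) hd₀.not_ge
  · have : 0 ≤ x i₀ j₀ + μ * d i₀ j₀ := h.1 i₀ j₀
    rw [le_div_iff₀ (by linarith)]
    linarith
  · refine add_mem_transportationPolytope hx (Submodule.smul_mem _ _ hd) fun i j => ?_
    change 0 ≤ x i j + μ * d i j
    rcases le_or_gt 0 (d i j) with hij | hij
    · have := mul_nonneg hμ hij
      have := hx.1 i j
      linarith
    · have h1 := h.trans (hmin (i, j) (mem_filter.2 ⟨mem_univ _, hij⟩))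
      rw [le_div_iff₀ (by simpa using hij)] at h1
      simp only at h1
      linarith

/-! ### The shadow vertex path. -/

/-- Every feasible circuit at `x` is positive for the objective `w + t • c`, ties being broken
by `c`. -/
def LexOptimal (w c : Matrix (Fin k) (Fin n) ℝ →ₗ[ℝ] ℝ) (t : ℝ)
    (x : Matrix (Fin k) (Fin n) ℝ) : Prop :=
  ∀ d ∈ circuits k n, Feasible x d → 0 ≤ w d + t * c d ∧ (w d + t * c d = 0 → 0 < c d)

/-- No two circuits in different directions along which `c` decreases have the same slope with
respect to `w` and `c`. -/
def GenericSlopes (w c : Matrix (Fin k) (Fin n) ℝ →ₗ[ℝ] ℝ) : Prop :=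
  ∀ d ∈ circuits k n, ∀ e ∈ circuits k n, c d < 0 → c e < 0 →
    w (c e • d - c d • e) = 0 → c e • d = c d • e

/-- One step of the shadow vertex rule. -/
theorem exists_shadow_step {w c : Matrix (Fin k) (Fin n) ℝ →ₗ[ℝ] ℝ} (hgen : GenericSlopes w c)
    {t : ℝ} (hx : x ∈ (transportationPolytope a b).extremePoints ℝ) (hopt : LexOptimal w c t x)
    (hdec : ∃ d ∈ circuits k n, Feasible x d ∧ c d < 0) :
    ∃ (y : Matrix (Fin k) (Fin n) ℝ) (t' : ℝ), PolytopeAdj (transportationPolytope a b) x y ∧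
      c y < c x ∧ LexOptimal w c t' y ∧ t < t' ∧
      ∃ d ∈ circuits k n, c d < 0 ∧ 0 < w d + t * c d ∧ w d + t' * c d = 0 := by
  classical
  obtain ⟨d₁, hd₁, hd₁f, hd₁c⟩ := hdec
  -- As `t` grows, `w + t • c` first vanishes on a feasible circuit at the least of these ratios.
  obtain ⟨d, hdm, hmin⟩ := exists_min_image
    ((circuits k n).filter fun d => Feasible x d ∧ c d < 0) (fun d => w d / -c d)
    ⟨d₁, mem_filter.2 ⟨hd₁, hd₁f, hd₁c⟩⟩
  obtain ⟨hd, hdf, hdc⟩ := mem_filter.1 hdm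
  have hdcirc := mem_circulations_of_mem_circuits hd
  have hd0 := ne_zero_of_mem_circuits hd
  set t' := w d / -c d with ht'
  have hdt : w d + t' * c d = 0 := by
    have := hdc.ne
    rw [ht']
    field_simp
    ring
  have hdt0 : 0 < w d + t * c d :=
    (hopt d hd hdf).1.lt_of_ne fun h => absurd ((hopt d hd hdf).2 h.symm) hdc.not_gt
  have htt' : t < t' := by
    by_contra! h
    have := mul_le_mul_of_nonpos_right h hdc.le
    linarith
  set f : Matrix (Fin k) (Fin n) ℝ →ₗ[ℝ] ℝ := w + t' • c with hf
  have hfa : ∀ e, f e = w e + t' * c e := fun e => rfl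
  -- A circuit with `c e ≥ 0` cannot be tight at `t'`, by `LexOptimal` at the smaller `t`.
  have hfeas : ∀ e ∈ circuits k n, Feasible x e → 0 ≤ f e ∧ (f e = 0 → c e < 0) := by
    intro e he hef
    rw [hfa]
    obtain ⟨h1, h2⟩ := hopt e he hef
    rcases lt_trichotomy (c e) 0 with h | h | h
    · have h3 := hmin e (mem_filter.2 ⟨he, hef, h⟩)
      rw [le_div_iff₀ (by linarith)] at h3
      exact ⟨by linarith, fun _ => h⟩
    · rw [h, mul_zero, add_zero] at h1 h2 ⊢
      exact ⟨h1, fun h3 => absurd (h2 h3) (lt_irrefl _)⟩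
    · have := mul_lt_mul_of_pos_right htt' h
      exact ⟨by linarith, fun h3 => by linarith⟩
  -- Tight circuits all share the slope of `d`, hence by genericity its direction.
  have hray : ∀ e ∈ circuits k n, Feasible x e → f e = 0 → ∃ μ : ℝ, 0 ≤ μ ∧ e = μ • d := by
    intro e he hef hfe
    have hec := (hfeas e he hef).2 hfe
    have h1 := hgen d hd e he hdc hec (by
      rw [map_sub, map_smul, map_smul, smul_eq_mul, smul_eq_mul]
      rw [hfa] at hfe
      linear_combination c e * hdt - c d * hfe)
    refine ⟨c e / c d, (div_pos_of_neg_of_neg hec hdc).le, ?_⟩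
    rw [div_eq_inv_mul, mul_smul, h1, smul_smul, inv_mul_cancel₀ hdc.ne, one_smul]
  have hmin' : ∀ z ∈ transportationPolytope a b, f x ≤ f z := fun z hz =>
    le_of_forall_feasible_circuit_nonneg hx.1 (fun e he hef => (hfeas e he hef).1) hz
  obtain ⟨s, hs, hstep⟩ := exists_max_step hx.1 hdcirc hd0 hdf
  -- The face minimizing `f` lies in the segment from `x` to `x + s • d`.
  have hF : ∀ z ∈ transportationPolytope a b, f z = f x →
      ∃ μ : ℝ, 0 ≤ μ ∧ μ ≤ s ∧ z = x + μ • d := by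
    intro z hz hzx
    obtain ⟨μ, hμ, rfl⟩ := exists_eq_add_smul_of_eq hx.1
      (fun e he hef => (hfeas e he hef).1) hray hz hzx
    exact ⟨μ, hμ, (hstep μ hμ).1 hz, rfl⟩
  have hfd : ∀ μ : ℝ, f (x + μ • d) = f x := fun μ => by
    rw [map_add, map_smul, hfa d, hdt, smul_zero, add_zero]
  set y := x + s • d with hy
  have hyP : y ∈ transportationPolytope a b := (hstep s hs.le).2 le_rfl
  have hsd : s • d ≠ 0 := smul_ne_zero hs.ne' hd0
  -- `IsExposed` is phrased with maximizers, hence `-f`.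
  refine ⟨y, t', ⟨hx, ?_, fun h => hsd (by simpa [hy] using h.symm), fun _ =>
    ⟨LinearMap.toContinuousLinearMap (-f), ?_⟩⟩, ?_, ?_, htt', d, hd, hdc, hdt0, hdt⟩
  -- Points with weighted mean `y` lie on the minimal face, with parameters at most `s` averaging to
  -- `s`.
  · refine ⟨hyP, fun z₁ hz₁ z₂ hz₂ hseg => ?_⟩
    obtain ⟨α, β, hα, hβ, hαβ, hcomb⟩ := hseg
    have hfy : α * f z₁ + β * f z₂ = f x := by
      rw [← hfd s, ← hy, ← hcomb]
      simp
    have h1 := hmin' z₁ hz₁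
    have h2 := hmin' z₂ hz₂
    have hsum : α * (f z₁ - f x) + β * (f z₂ - f x) = 0 := by
      linear_combination hfy - f x * hαβ
    have h1' := mul_nonneg hα.le (sub_nonneg.2 h1)
    have h2' := mul_nonneg hβ.le (sub_nonneg.2 h2)
    have hz₁x : f z₁ = f x := sub_eq_zero.1
      ((mul_eq_zero.1 (by linarith : α * (f z₁ - f x) = 0)).resolve_left hα.ne')
    have hz₂x : f z₂ = f x := sub_eq_zero.1
      ((mul_eq_zero.1 (by linarith : β * (f z₂ - f x) = 0)).resolve_left hβ.ne')
    obtain ⟨μ₁, -, hμ₁, rfl⟩ := hF z₁ hz₁ hz₁x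
    obtain ⟨μ₂, -, hμ₂, rfl⟩ := hF z₂ hz₂ hz₂x
    have h3 : (α * μ₁ + β * μ₂) • d = s • d := by
      have : α • (x + μ₁ • d) + β • (x + μ₂ • d) =
          (α + β) • x + (α * μ₁ + β * μ₂) • d := by module
      rw [this, hαβ, one_smul] at hcomb
      exact add_left_cancel hcomb
    have h4 := smul_left_injective ℝ hd0 h3
    have h5 : μ₁ = s := by nlinarith
    rw [h5]
  · ext z
    simp only [LinearMap.coe_toContinuousLinearMap', LinearMap.neg_apply, neg_le_neg_iff,
      Set.mem_ofPred_eq]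
    constructor
    · rintro ⟨α, β, hα, hβ, hαβ, rfl⟩
      have : α • x + β • y = x + (β * s) • d := by
        rw [hy]
        have : α = 1 - β := by linarith
        rw [this]
        module
      rw [this]
      refine ⟨(hstep _ (by positivity)).2 (by nlinarith), fun z hz => ?_⟩
      rw [hfd]
      exact hmin' z hz
    · rintro ⟨hz, hzmin⟩
      obtain ⟨μ, hμ0, hμ, rfl⟩ := hF z hz (le_antisymm (hzmin x hx.1) (hmin' z hz))
      refine ⟨1 - μ / s, μ / s, ?_, by positivity, by ring, ?_⟩
      · rw [sub_nonneg, div_le_one hs]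
        exact hμ
      · rw [hy, smul_add, smul_smul, div_mul_cancel₀ _ hs.ne']
        module
  · rw [hy, map_add, map_smul, smul_eq_mul]
    nlinarith
  -- A short step from `y` along a tight circuit stays on the edge, so it heads back towards `x`,
  -- where `c` is larger.
  · intro e he hef
    obtain ⟨ε, hεP, hε⟩ := ((hef.eventually_add_smul_mem hyP
      (mem_circulations_of_mem_circuits he)).and self_mem_nhdsWithin).exists
    have hε' : 0 < ε := hε
    have h1 := hmin' _ hεP
    rw [map_add, hfd, map_smul, smul_eq_mul] at h1
    rw [← hfa]
    refine ⟨nonneg_of_mul_nonneg_right (by linarith) hε', fun h2 => ?_⟩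
    obtain ⟨μ, -, hμ, hμe⟩ := hF _ hεP (by rw [map_add, hfd, map_smul, h2, smul_zero, add_zero])
    have h3 : ε • e = (μ - s) • d := by
      rw [hy, add_assoc] at hμe
      rw [sub_smul, ← add_left_cancel hμe]
      abel
    have h4 : μ ≠ s := by
      rintro rfl
      rw [sub_self, zero_smul] at h3
      exact smul_ne_zero hε'.ne' (ne_zero_of_mem_circuits he) h3
    have h5 := congrArg c h3
    rw [map_smul, map_smul, smul_eq_mul, smul_eq_mul] at h5
    have h6 : 0 < ε * c e := by
      rw [h5]
      exact mul_pos_of_neg_of_neg (sub_neg.2 (hμ.lt_of_ne h4)) hdc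
    exact pos_of_mul_pos_right h6 hε'.le

theorem IsMonotonePath.cons {E : Type*} [AddCommGroup E] [Module ℝ E] [TopologicalSpace E]
    {P : Set E} {c : E →ₗ[ℝ] ℝ} {l : ℕ} {p : Fin (l + 1) → E} (hp : IsMonotonePath P c l p)
    {x : E} (hadj : PolytopeAdj P x (p 0)) (hlt : c (p 0) < c x) :
    IsMonotonePath P c (l + 1) (Fin.cons x p : Fin (l + 2) → E) := by
  refine ⟨hadj.1, fun i => ?_, hp.2.2⟩
  induction i using Fin.cases with
  | zero => exact ⟨hadj, hlt⟩
  | succ i => exact hp.2.1 i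

/-- From a vertex that is optimal for `w + t • c`, the shadow vertex rule reaches the optimum of
`c`, each step using up the slope of at least one circuit. -/
theorem exists_monotonePath_of_lexOptimal {w c : Matrix (Fin k) (Fin n) ℝ →ₗ[ℝ] ℝ}
    (hgen : GenericSlopes w c) {t : ℝ} (hx : x ∈ (transportationPolytope a b).extremePoints ℝ)
    (hopt : LexOptimal w c t x) :
    ∃ l ≤ #{d ∈ circuits k n | c d < 0 ∧ 0 < w d + t * c d}, ∃ p : Fin (l + 1) → _,
      p 0 = x ∧ IsMonotonePath (transportationPolytope a b) c l p := by
  classical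
  induction hN : #{d ∈ circuits k n | c d < 0 ∧ 0 < w d + t * c d} using Nat.strong_induction_on
    generalizing x t with
  | _ N ih =>
  by_cases hdec : ∃ d ∈ circuits k n, Feasible x d ∧ c d < 0
  · obtain ⟨y, t', hadj, hlt, hopt', htt', d, hd, hdc, hdt, hdt'⟩ :=
      exists_shadow_step hgen hx hopt hdec
    -- Raising `t` to `t'` only shrinks this set of circuits, and `d` leaves it.
    have hcard : #{d ∈ circuits k n | c d < 0 ∧ 0 < w d + t' * c d} < N := by
      rw [← hN]
      refine card_lt_card (Finset.ssubset_iff_of_subset ?_ |>.2 ⟨d, ?_, ?_⟩)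
      · intro e he
        rw [mem_filter] at he ⊢
        have := mul_lt_mul_of_neg_right htt' he.2.1
        exact ⟨he.1, he.2.1, by linarith [he.2.2]⟩
      · exact mem_filter.2 ⟨hd, hdc, hdt⟩
      · rw [mem_filter, hdt']
        simp
    obtain ⟨l, hl, p, rfl, hp⟩ := ih _ hcard hadj.2.1 hopt' rfl
    exact ⟨l + 1, by omega, Fin.cons x p, rfl, hp.cons hadj hlt⟩
  · push Not at hdec
    exact ⟨0, Nat.zero_le _, fun _ => x, rfl, hx, fun i => i.elim0, hx, fun z hz =>
      le_of_forall_feasible_circuit_nonneg hx.1 hdec hz⟩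

/-! ### Generic objectives minimized at a given vertex. -/

/-- Finitely many vectors that do not vanish on `S` are simultaneously nonorthogonal to some vector
that is positive on `S` and zero elsewhere. -/
theorem exists_pos_on_forall_sum_ne_zero {ι : Type*} [Fintype ι] (S : Set ι)
    (H : Finset (ι → ℝ)) (hH : ∀ h ∈ H, ∃ i ∈ S, h i ≠ 0) :
    ∃ u : ι → ℝ, (∀ i ∈ S, 0 < u i) ∧ (∀ i ∉ S, u i = 0) ∧ ∀ h ∈ H, ∑ i, u i * h i ≠ 0 := by
  classical
  let e := Fintype.equivFin ι
  -- With `u i = s ^ e i` on `S`, the sum against `h` is the value of `F h` at `s`; any positive `s`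
  -- that is not a root works.
  let F : (ι → ℝ) → ℝ[X] := fun h => ∑ i, if i ∈ S then monomial (e i : ℕ) (h i) else 0
  have hF : ∀ h ∈ H, F h ≠ 0 := by
    intro h hh h0
    obtain ⟨i, hi, hne⟩ := hH h hh
    have := congrArg (fun P => coeff P (e i : ℕ)) h0
    simp only [F, finsetSum_coeff, coeff_zero] at this
    rw [sum_eq_single i] at this
    · rw [if_pos hi, coeff_monomial, if_pos rfl] at this
      exact hne this
    · intro j _ hji
      split_ifs
      · rw [coeff_monomial, if_neg]
        intro h
        exact hji (e.injective (Fin.ext h))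
      · simp
    · simp
  obtain ⟨s, hs, hs'⟩ := (Set.Ioi_infinite (0 : ℝ)).exists_notMem_finset
    (H.biUnion fun h => (F h).roots.toFinset)
  have hs0 : 0 < s := hs
  refine ⟨fun i => if i ∈ S then s ^ (e i : ℕ) else 0, fun i hi => ?_, fun i hi => by simp [hi],
    fun h hh h0 => hs' (mem_biUnion.2 ⟨h, hh, ?_⟩)⟩
  · simp only [hi, if_true]
    positivity
  · rw [Multiset.mem_toFinset, mem_roots (hF h hh), IsRoot.def, ← h0, eval_finsetSum]
    refine sum_congr rfl fun i _ => ?_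
    dsimp only
    split_ifs
    · rw [eval_monomial, mul_comm]
    · simp

/-- Every vertex is optimal for an objective in general position to `c`. -/
theorem exists_generic_lexOptimal (c : Matrix (Fin k) (Fin n) ℝ →ₗ[ℝ] ℝ)
    (hv : v ∈ (transportationPolytope a b).extremePoints ℝ) :
    ∃ w : Matrix (Fin k) (Fin n) ℝ →ₗ[ℝ] ℝ, GenericSlopes w c ∧ LexOptimal w c 0 v := by
  classical
  let flat : Matrix (Fin k) (Fin n) ℝ → Fin k × Fin n → ℝ := fun z s => z s.1 s.2
  let S : Set (Fin k × Fin n) := {s | v s.1 s.2 = 0}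
  -- `w` must not vanish on `Z`. Its members are nonzero circulations, so each has a nonzero entry
  -- where `v` is zero.
  let Z : Finset (Matrix (Fin k) (Fin n) ℝ) :=
    ((circuits k n ×ˢ circuits k n).image fun q => c q.2 • q.1 - c q.1 • q.2).filter (· ≠ 0)
  have hZ : ∀ h ∈ Z.image flat, ∃ s ∈ S, h s ≠ 0 := by
    intro h hh
    obtain ⟨z, hz, rfl⟩ := mem_image.1 hh
    obtain ⟨hz, hz0⟩ := mem_filter.1 hz
    obtain ⟨⟨d, e⟩, hde, rfl⟩ := mem_image.1 hz
    rw [mem_product] at hde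
    obtain ⟨i, j, hij, hne⟩ := exists_eq_zero_and_ne_zero_of_mem_extremePoints hv
      (sub_mem (Submodule.smul_mem _ _ (mem_circulations_of_mem_circuits hde.1))
        (Submodule.smul_mem _ _ (mem_circulations_of_mem_circuits hde.2))) hz0
    exact ⟨(i, j), hij, hne⟩
  obtain ⟨u, hupos, huzero, hu⟩ := exists_pos_on_forall_sum_ne_zero S _ hZ
  let w : Matrix (Fin k) (Fin n) ℝ →ₗ[ℝ] ℝ :=
    { toFun := fun z => ∑ s : Fin k × Fin n, u s * z s.1 s.2
      map_add' := fun y z => by simp [mul_add, sum_add_distrib]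
      map_smul' := fun r z => by simp [mul_sum, mul_left_comm] }
  have hw : ∀ z, w z = ∑ s : Fin k × Fin n, u s * z s.1 s.2 := fun z => rfl
  refine ⟨w, fun d hd e he _ _ h => ?_, fun d hd hdf => ?_⟩
  · by_contra hne
    exact hu _ (mem_image_of_mem flat (mem_filter.2 ⟨mem_image.2
      ⟨(d, e), mem_product.2 ⟨hd, he⟩, rfl⟩, sub_ne_zero.2 hne⟩)) h
  · obtain ⟨i, j, hij, hne⟩ := exists_eq_zero_and_ne_zero_of_mem_extremePoints hv
      (mem_circulations_of_mem_circuits hd) (ne_zero_of_mem_circuits hd)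
    -- The weights of `w` live on the zero entries of `v`, where a feasible `d` is nonnegative and
    -- not identically zero.
    have hpos : 0 < w d := by
      rw [hw]
      refine sum_pos' (fun s _ => ?_) ⟨(i, j), mem_univ _, ?_⟩
      · by_cases hs : s ∈ S
        · exact mul_nonneg (hupos s hs).le (hdf _ _ hs)
        · simp [huzero s hs]
      · exact mul_pos (hupos _ hij) ((hdf i j hij).lt_of_ne hne.symm)
    rw [zero_mul, add_zero]
    exact ⟨hpos.le, fun h => absurd h hpos.ne'⟩

/-! ### The bounds on the monotone diameter. -/

theorem monotoneDiameter_transportationPolytope_le_card_circuits (a : Fin k → ℝ)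
    (b : Fin n → ℝ) :
    monotoneDiameter (transportationPolytope a b) ≤ (#(circuits k n) : ℕ∞) := by
  refine iSup₂_le fun c _ => iSup₂_le fun v hv => ?_
  obtain ⟨w, hgen, hopt⟩ := exists_generic_lexOptimal c hv
  obtain ⟨l, hl, p, hp⟩ := exists_monotonePath_of_lexOptimal hgen hv hopt
  refine (iInf₂_le l ⟨p, hp⟩).trans ?_
  exact_mod_cast hl.trans (card_filter_le _ _)

end Path

theorem mainTheorem4 :
    (∀ (k n : ℕ) (a : Fin k → ℝ) (b : Fin n → ℝ),
      (monotoneDiameter (transportationPolytope a b) : ℝ≥0∞) ≤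
        ENNReal.ofReal (Real.exp 1 * (k ! : ℝ) * (n : ℝ) ^ k)) ∧
    (∀ k : ℕ, ∃ p : Polynomial ℕ, ∀ (n : ℕ) (a : Fin k → ℝ) (b : Fin n → ℝ),
      monotoneDiameter (transportationPolytope a b) ≤ ((p.eval n : ℕ) : ℕ∞)) := by
  have key : ∀ (k n : ℕ) (a : Fin k → ℝ) (b : Fin n → ℝ),
      monotoneDiameter (transportationPolytope a b) ≤
        ((∑ m ∈ range k, k.descFactorial (m + 1) * n ^ (m + 1) : ℕ) : ℕ∞) := fun k n a b =>
    (monotoneDiameter_transportationPolytope_le_card_circuits a b).trans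
      (by exact_mod_cast card_circuits_le k n)
  -- The bound on the circuit count is already a polynomial in `n` over `ℕ`, so it serves as `p`.
  refine ⟨fun k n a b => ?_, fun k =>
    ⟨∑ m ∈ range k, C (k.descFactorial (m + 1)) * X ^ (m + 1), fun n a b => ?_⟩⟩
  · refine (ENat.toENNReal_le.2 (key k n a b)).trans ?_
    rw [ENat.toENNReal_coe, ← ENNReal.ofReal_natCast]
    exact ENNReal.ofReal_le_ofReal (sum_descFactorial_mul_pow_le k n)
  · refine (key k n a b).trans_eq ?_
    simp [eval_finsetSum]
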